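/- Let $n,\alpha\ge 0$ be integers, $x=(x_1,\dots,x_n)$, and let $A\in\mathbb R[x]^{\alpha\times\alpha}$ be a linear pencil, i.e. a symmetric matrix whose entries are polynomials of degree at most $1$. Put $$S_A:=\{a\in\mathbb R^n \mid A(a)\succeq 0\},$$ $$C_A:=\Big\{c+\sum_i u_i^*Au_i \;\Big|\; c\in\mathbb R_{\ge 0},\ u_i\in\mathbb R^\alpha\Big\},\qquad M_A:=\Big\{s+\sum_i v_i^*Av_i \;\Big|\; s\in\mathbb R[x] \text{ a sum of squares},\ v_i\in\mathbb R[x]^\alpha\Big\},$$ where all sums are finite and $^*$ denotes the transpose. Then $C_A$ is a convex cone and $M_A$ is a quadratic module in $\mathbb R[x]$ (it contains $1$ and is closed under addition and under multiplication with squares), so that its support $\operatorname{supp} M_A:=M_A\cap(-M_A)$ is an ideal of $\mathbb R[x]$; let $\sqrt{\operatorname{supp} M_A}$ be the radical of this ideal. Then for every polynomial $f\in\mathbb R[x]$ of degree at most $1$, $$f\ge 0\ \text{ on } S_A\quad\Longleftrightarrow\quad f\in C_A+\sqrt{\operatorname{supp} M_A}.$$ -/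

import Mathlib

open scoped Pointwise

namespace LMI

/-- A quadratic module in a commutative ring: a subset that contains `1` and is closed under
addition and under multiplication with squares. -/
structure QuadraticModule (R : Type*) [CommRing R] where
  carrier : Set R
  one_mem : (1 : R) ∈ carrier
  add_mem : ∀ {a b : R}, a ∈ carrier → b ∈ carrier → a + b ∈ carrier
  sq_mul_mem : ∀ (a : R) {b : R}, b ∈ carrier → a ^ 2 * b ∈ carrier

theorem QuadraticModule.zero_mem {R : Type*} [CommRing R] (M : QuadraticModule R) :
    (0 : R) ∈ M.carrier := by
  simpa using M.sq_mul_mem 0 M.one_mem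

theorem QuadraticModule.mul_mem_of_mem_of_neg_mem {R : Type*} [CommRing R]
    (M : QuadraticModule R) (h2 : IsUnit (2 : R)) (a : R) {p : R}
    (hp : p ∈ M.carrier) (hn : -p ∈ M.carrier) : a * p ∈ M.carrier := by
  obtain ⟨b, hb⟩ := h2.exists_right_inv
  have h := M.sq_mul_mem b (M.add_mem (M.sq_mul_mem (a + 1) hp) (M.sq_mul_mem (a - 1) hn))
  have e : b ^ 2 * ((a + 1) ^ 2 * p + (a - 1) ^ 2 * -p) = (2 * b) ^ 2 * (a * p) := by ring
  rw [e, hb] at h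
  simpa using h

/-- The support `M ∩ -M` of a quadratic module. It is an ideal because `2` is a unit. -/
def QuadraticModule.support {R : Type*} [CommRing R] (M : QuadraticModule R)
    (h2 : IsUnit (2 : R)) : Ideal R where
  carrier := M.carrier ∩ -M.carrier
  zero_mem' := ⟨M.zero_mem, by simpa using M.zero_mem⟩
  add_mem' := by
    rintro a b ⟨ha, ha'⟩ ⟨hb, hb'⟩
    refine ⟨M.add_mem ha hb, ?_⟩
    rw [Set.mem_neg] at *
    rw [neg_add]
    exact M.add_mem ha' hb'
  smul_mem' := by
    rintro a p ⟨hp, hp'⟩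
    rw [Set.mem_neg] at hp'
    refine ⟨M.mul_mem_of_mem_of_neg_mem h2 a hp hp', ?_⟩
    rw [Set.mem_neg, smul_eq_mul, ← mul_neg]
    exact M.mul_mem_of_mem_of_neg_mem h2 a hp' (by rwa [neg_neg])

/-- A linear pencil: a symmetric matrix polynomial whose entries have degree at most `1`. -/
structure IsLinearPencil {n α : ℕ}
    (A : Matrix (Fin α) (Fin α) (MvPolynomial (Fin n) ℝ)) : Prop where
  isSymm : A.IsSymm
  totalDegree_le : ∀ i j, (A i j).totalDegree ≤ 1

/-- The spectrahedron `S_A` of all real points at which `A` is positive semidefinite. -/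
def spectrahedron {n α : ℕ} (A : Matrix (Fin α) (Fin α) (MvPolynomial (Fin n) ℝ)) :
    Set (Fin n → ℝ) :=
  {x | (A.map (MvPolynomial.eval x)).PosSemidef}

/-- The polynomial `∑ i, v i ^* A (v i)` for a finite family of polynomial vectors `v i`. -/
noncomputable def quadSum {n α k : ℕ} (A : Matrix (Fin α) (Fin α) (MvPolynomial (Fin n) ℝ))
    (v : Fin k → Fin α → MvPolynomial (Fin n) ℝ) : MvPolynomial (Fin n) ℝ :=
  ∑ i, v i ⬝ᵥ (A.mulVec (v i))

theorem quadSum_append {n α k l : ℕ} (A : Matrix (Fin α) (Fin α) (MvPolynomial (Fin n) ℝ))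
    (v : Fin k → Fin α → MvPolynomial (Fin n) ℝ) (w : Fin l → Fin α → MvPolynomial (Fin n) ℝ) :
    quadSum A (Fin.append v w) = quadSum A v + quadSum A w := by
  simp [quadSum, Fin.sum_univ_add]

theorem quadSum_smul {n α k : ℕ} (A : Matrix (Fin α) (Fin α) (MvPolynomial (Fin n) ℝ))
    (a : MvPolynomial (Fin n) ℝ) (v : Fin k → Fin α → MvPolynomial (Fin n) ℝ) :
    quadSum A (fun i => a • v i) = a ^ 2 * quadSum A v := by
  simp [quadSum, Finset.mul_sum, Matrix.mulVec_smul, sq, mul_assoc]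

/-- The convex cone `C_A` of all `c + ∑ i, u i ^* A (u i)` with a real number `c ≥ 0` and finitely
many real vectors `u i`. -/
noncomputable def pencilCone {n α : ℕ} (A : Matrix (Fin α) (Fin α) (MvPolynomial (Fin n) ℝ)) :
    ConvexCone ℝ (MvPolynomial (Fin n) ℝ) where
  carrier := {p | ∃ c : ℝ, 0 ≤ c ∧ ∃ (k : ℕ) (u : Fin k → Fin α → ℝ),
    p = MvPolynomial.C c + quadSum A (fun i j => MvPolynomial.C (u i j))}
  smul_mem' := by
    rintro r hr _ ⟨c, hc, k, u, rfl⟩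
    refine ⟨r * c, by positivity, k, fun i j => √r * u i j, ?_⟩
    have e : (fun i j => MvPolynomial.C (√r * u i j)) = fun (i : Fin k) =>
        (MvPolynomial.C √r : MvPolynomial (Fin n) ℝ) • fun j : Fin α =>
          (MvPolynomial.C (u i j) : MvPolynomial (Fin n) ℝ) := by
      ext1 i
      ext1 j
      simp
    rw [e, quadSum_smul, ← MvPolynomial.C_pow, Real.sq_sqrt hr.le, MvPolynomial.smul_eq_C_mul,
      mul_add, MvPolynomial.C_mul]
  add_mem' := by
    rintro _ ⟨c, hc, k, u, rfl⟩ _ ⟨d, hd, l, w, rfl⟩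
    refine ⟨c + d, by positivity, k + l, Fin.append u w, ?_⟩
    have e : (fun i j => (MvPolynomial.C (Fin.append u w i j) : MvPolynomial (Fin n) ℝ)) =
        Fin.append (fun i j => MvPolynomial.C (u i j)) (fun i j => MvPolynomial.C (w i j)) := by
      ext1 i
      refine Fin.addCases (fun i => ?_) (fun i => ?_) i <;> simp
    rw [e, quadSum_append, MvPolynomial.C_add]
    ring

/-- The quadratic module `M_A` of all `s + ∑ i, v i ^* A (v i)` with a sum of squares of
polynomials `s` and finitely many polynomial vectors `v i`. -/
noncomputable def pencilModule {n α : ℕ} (A : Matrix (Fin α) (Fin α) (MvPolynomial (Fin n) ℝ)) :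
    QuadraticModule (MvPolynomial (Fin n) ℝ) where
  carrier := {p | ∃ s : MvPolynomial (Fin n) ℝ, IsSumSq s ∧
    ∃ (k : ℕ) (v : Fin k → Fin α → MvPolynomial (Fin n) ℝ), p = s + quadSum A v}
  one_mem := ⟨1, IsSumSq.one, 0, Fin.elim0, by simp [quadSum]⟩
  add_mem := by
    rintro _ _ ⟨s, hs, k, v, rfl⟩ ⟨t, ht, l, w, rfl⟩
    refine ⟨s + t, hs.add ht, k + l, Fin.append v w, ?_⟩
    rw [quadSum_append]
    ring
  sq_mul_mem := by
    rintro a _ ⟨s, hs, k, v, rfl⟩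
    refine ⟨a ^ 2 * s, (IsSquare.sq a).isSumSq.mul hs, k, fun i => a • v i, ?_⟩
    rw [quadSum_smul, mul_add]

theorem isUnit_two (n : ℕ) : IsUnit (2 : MvPolynomial (Fin n) ℝ) := by
  have h : IsUnit (MvPolynomial.C (2 : ℝ) : MvPolynomial (Fin n) ℝ) :=
    (isUnit_iff_ne_zero.mpr two_ne_zero).map MvPolynomial.C
  rwa [map_ofNat] at h

end LMI

/-! Let `I` be the radical of the support of `M_A`. If `h ^ k` lies in `M_A ∩ -M_A`, it vanishes on
`S_A`, so `I` vanishes there; as `C_A` is nonnegative on `S_A`, one direction follows. Conversely,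
suppose `f ∉ C_A + I`. Modulo `I`, the polynomials of degree at most `1` form a finite-dimensional
space. Consider the elements `c - d f + uᵀAu` with `c, d ≥ 0`, where `u` runs through a complement
of the vectors with `Au ≡ 0`, normalised to the unit sphere. They form a compact set whose convex
hull misses `0` (`sum_generators_notMem`). A strictly separating functional is positive at `1`,
negative at `f` and nonnegative at every `uᵀAu`; after scaling it is evaluation at a point of `S_A`
where `f < 0`. The convex hull misses `0` because of two properties of `I`: if a sum of elements of
`M_A` lies in `I`, so does each summand (`mem_radical_support_of_add_mem`), and `uᵀAu ∈ I` forces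
`Au ∈ I` (`mulVec_mem_radical`). -/

namespace LMI

/-! ### Compactness of convex hulls -/

/-- Carathéodory: in finite dimension the convex hull of a compact set is compact. -/
theorem isCompact_convexHull_of_isCompact {E : Type*} [NormedAddCommGroup E] [NormedSpace ℝ E]
    [FiniteDimensional ℝ E] {K : Set E} (hK : IsCompact K) : IsCompact (convexHull ℝ K) := by
  rcases K.eq_empty_or_nonempty with rfl | ⟨z₀, hz₀⟩
  · simp
  let N := Module.finrank ℝ E + 1
  have hc : Continuous fun p : (Fin N → ℝ) × (Fin N → E) => ∑ i, p.1 i • p.2 i := by fun_prop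
  have hT := ((isCompact_stdSimplex ℝ (Fin N)).prod
    (isCompact_univ_pi fun _ : Fin N => hK)).image hc
  convert hT using 1
  apply Set.Subset.antisymm
  · intro x hx
    obtain ⟨ι, hι, z, w, hzK, hind, hw, hw1, rfl⟩ := eq_pos_convex_span_of_mem_convexHull hx
    have hcard : Fintype.card ι ≤ Fintype.card (Fin N) := by
      simpa [N] using hind.card_le_finrank_succ.trans
        (Nat.add_le_add_right (Submodule.finrank_le _) 1)
    obtain ⟨e⟩ := Function.Embedding.nonempty_of_card_le hcard
    -- Pad to exactly `N` points: the unused indices get weight `0` and the dummy point `z₀ ∈ K`.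
    refine ⟨(Function.extend e w 0, Function.extend e z fun _ => z₀), ⟨⟨fun j => ?_, ?_⟩,
      fun j _ => ?_⟩, ?_⟩
    · by_cases h : ∃ i, e i = j
      · obtain ⟨i, rfl⟩ := h
        simpa [e.injective.extend_apply] using (hw i).le
      · simp [Function.extend_apply' _ _ _ h]
    · rw [← hw1]
      refine (Fintype.sum_of_injective e e.injective _ _ (fun j hj => ?_) fun i => ?_).symm
      · simp [Function.extend_apply' _ _ _ hj]
      · simp [e.injective.extend_apply]
    · by_cases h : ∃ i, e i = j
      · obtain ⟨i, rfl⟩ := h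
        simpa [e.injective.extend_apply] using hzK (Set.mem_range_self i)
      · simpa [Function.extend_apply' _ _ _ h] using hz₀
    · refine (Fintype.sum_of_injective e e.injective _ _ (fun j hj => ?_) fun i => ?_).symm
      · simp [Function.extend_apply' _ _ _ hj]
      · simp [e.injective.extend_apply]
  · rintro _ ⟨⟨w, z⟩, ⟨⟨hw, hw1⟩, hz⟩, rfl⟩
    exact mem_convexHull_of_exists_fintype w z hw hw1 (fun i => hz i (Set.mem_univ i)) rfl

/-! ### The radical of the support is convex with respect to the quadratic module -/

namespace QuadraticModule

variable {R : Type*} [CommRing R] (M : QuadraticModule R)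

theorem sum_mem {ι : Type*} (s : Finset ι) {p : ι → R} (h : ∀ i ∈ s, p i ∈ M.carrier) :
    ∑ i ∈ s, p i ∈ M.carrier :=
  Finset.sum_induction p (· ∈ M.carrier) (fun _ _ => M.add_mem) M.zero_mem h

theorem natCast_mul_mem (k : ℕ) {p : R} (h : p ∈ M.carrier) : (k : R) * p ∈ M.carrier := by
  simpa using M.sum_mem (Finset.range k) (p := fun _ => p) fun _ _ => h

/-- Exactly one exponent is odd, so the product is a square times `p` or `q`; products of elements
of `M` need not lie in `M` in general. -/
theorem pow_mul_pow_mem {p q : R} (hp : p ∈ M.carrier) (hq : q ∈ M.carrier) {a b : ℕ}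
    (h : Odd (a + b)) : p ^ a * q ^ b ∈ M.carrier := by
  rcases Nat.even_or_odd a with ha | ha
  · obtain ⟨d, rfl⟩ : Odd b := (Nat.odd_add'.1 h).2 ha
    obtain ⟨c, rfl⟩ := ha
    have := M.sq_mul_mem (p ^ c * q ^ d) hq
    convert this using 1
    ring
  · obtain ⟨d, rfl⟩ : Even b := (Nat.odd_add.1 h).1 ha
    obtain ⟨c, rfl⟩ := ha
    have := M.sq_mul_mem (p ^ c * q ^ d) hp
    convert this using 1
    ring

/-- Raise `p + q` to an odd power `N` lying in the support. Every term of the binomial expansion has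
odd total degree and hence lies in `M`, so `-p ^ N` is `-(p + q) ^ N` plus elements of `M`. -/
theorem mem_radical_support_of_add_mem (h2 : IsUnit (2 : R)) {p q : R} (hp : p ∈ M.carrier)
    (hq : q ∈ M.carrier) (h : p + q ∈ (M.support h2).radical) :
    p ∈ (M.support h2).radical := by
  obtain ⟨k, hk⟩ := h
  have hN : (p + q) ^ (2 * k + 1) ∈ M.support h2 :=
    Ideal.pow_mem_of_pow_mem _ hk (by omega)
  have hterm : ∀ i ∈ Finset.range (2 * k + 1 + 1),
      p ^ i * q ^ (2 * k + 1 - i) * ((2 * k + 1).choose i : R) ∈ M.carrier := by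
    intro i hi
    rw [mul_comm]
    refine M.natCast_mul_mem _ (M.pow_mul_pow_mem hp hq ?_)
    rw [Nat.add_sub_cancel' (Finset.mem_range_succ_iff.1 hi)]
    exact odd_two_mul_add_one k
  rw [add_pow, Finset.sum_range_succ] at hN
  have hpN : p ^ (2 * k + 1) ∈ M.carrier := by
    simpa using M.pow_mul_pow_mem hp hq (a := 2 * k + 1) (b := 0) (odd_two_mul_add_one k)
  refine ⟨2 * k + 1, hpN, ?_⟩
  have := M.add_mem hN.2
    (M.sum_mem _ fun i hi => hterm i (Finset.mem_range.2 (Nat.lt_succ_of_lt (Finset.mem_range.1 hi))))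
  simpa using this

theorem mem_radical_support_of_sum_mem (h2 : IsUnit (2 : R)) {ι : Type*} {s : Finset ι}
    {p : ι → R} (hp : ∀ i ∈ s, p i ∈ M.carrier) (h : ∑ i ∈ s, p i ∈ (M.support h2).radical)
    {i : ι} (hi : i ∈ s) : p i ∈ (M.support h2).radical := by
  classical
  rw [← Finset.add_sum_erase _ _ hi] at h
  exact M.mem_radical_support_of_add_mem h2 (hp i hi)
    (M.sum_mem _ fun j hj => hp j (Finset.mem_of_mem_erase hj)) h

end QuadraticModule

/-! ### Positivity on the spectrahedron and the kernel of the pencil modulo the radical -/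

section Pencil

variable {n α : ℕ} {A : Matrix (Fin α) (Fin α) (MvPolynomial (Fin n) ℝ)}

theorem dotProduct_mulVec_mem_pencilModule (v : Fin α → MvPolynomial (Fin n) ℝ) :
    v ⬝ᵥ A.mulVec v ∈ (pencilModule A).carrier :=
  ⟨0, IsSumSq.zero, 1, fun _ => v, by simp [quadSum]⟩

theorem C_mem_pencilModule {c : ℝ} (hc : 0 ≤ c) :
    MvPolynomial.C c ∈ (pencilModule A).carrier := by
  have := (pencilModule A).sq_mul_mem (MvPolynomial.C √c) (pencilModule A).one_mem
  rwa [mul_one, ← MvPolynomial.C_pow, Real.sq_sqrt hc] at this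

theorem C_mem_pencilCone {c : ℝ} (hc : 0 ≤ c) : MvPolynomial.C c ∈ pencilCone A :=
  ⟨c, hc, 0, Fin.elim0, by simp [quadSum]⟩

theorem dotProduct_mulVec_mem_pencilCone (u : Fin α → ℝ) :
    (fun j => MvPolynomial.C (u j)) ⬝ᵥ A.mulVec (fun j => MvPolynomial.C (u j)) ∈ pencilCone A :=
  ⟨0, le_rfl, 1, fun _ => u, by simp [quadSum]⟩

theorem zero_mem_pencilCone : (0 : MvPolynomial (Fin n) ℝ) ∈ pencilCone A := by
  simpa using C_mem_pencilCone (A := A) le_rfl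

theorem smul_mem_pencilCone {r : ℝ} (hr : 0 ≤ r) {p : MvPolynomial (Fin n) ℝ}
    (hp : p ∈ pencilCone A) : r • p ∈ pencilCone A := by
  rcases hr.eq_or_lt with rfl | hr
  · simpa using zero_mem_pencilCone
  · exact (pencilCone A).smul_mem hr hp

theorem smul_mem_pencilModule {r : ℝ} (hr : 0 ≤ r) {p : MvPolynomial (Fin n) ℝ}
    (hp : p ∈ (pencilModule A).carrier) : r • p ∈ (pencilModule A).carrier := by
  have := (pencilModule A).sq_mul_mem (MvPolynomial.C √r) hp
  rwa [← MvPolynomial.C_pow, Real.sq_sqrt hr, ← MvPolynomial.smul_eq_C_mul] at this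

theorem sum_mem_pencilCone {ι : Type*} (s : Finset ι) {p : ι → MvPolynomial (Fin n) ℝ}
    (h : ∀ i ∈ s, p i ∈ pencilCone A) : ∑ i ∈ s, p i ∈ pencilCone A :=
  Finset.sum_induction p (· ∈ pencilCone A) (fun _ _ ha hb => (pencilCone A).add_mem ha hb)
    zero_mem_pencilCone h

theorem eval_dotProduct_mulVec (x : Fin n → ℝ) (v : Fin α → MvPolynomial (Fin n) ℝ) :
    MvPolynomial.eval x (v ⬝ᵥ A.mulVec v) =
      (fun j => MvPolynomial.eval x (v j)) ⬝ᵥ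
        (A.map (MvPolynomial.eval x)).mulVec fun j => MvPolynomial.eval x (v j) := by
  simp [dotProduct, Matrix.mulVec]

theorem eval_quadSum_nonneg {x : Fin n → ℝ} (hx : x ∈ spectrahedron A) {k : ℕ}
    (v : Fin k → Fin α → MvPolynomial (Fin n) ℝ) :
    0 ≤ MvPolynomial.eval x (quadSum A v) := by
  rw [quadSum, map_sum]
  refine Finset.sum_nonneg fun i _ => ?_
  rw [eval_dotProduct_mulVec]
  simpa using Matrix.PosSemidef.dotProduct_mulVec_nonneg hx
    fun j => MvPolynomial.eval x (v i j)

theorem eval_nonneg_of_mem_pencilModule {x : Fin n → ℝ} (hx : x ∈ spectrahedron A)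
    {p : MvPolynomial (Fin n) ℝ} (hp : p ∈ (pencilModule A).carrier) :
    0 ≤ MvPolynomial.eval x p := by
  obtain ⟨s, hs, k, v, rfl⟩ := hp
  rw [map_add]
  refine add_nonneg ?_ (eval_quadSum_nonneg hx v)
  induction hs with
  | zero => simp
  | sq_add a _ ih =>
    rw [map_add, map_mul]
    exact add_nonneg (mul_self_nonneg _) ih

theorem eval_nonneg_of_mem_pencilCone {x : Fin n → ℝ} (hx : x ∈ spectrahedron A)
    {p : MvPolynomial (Fin n) ℝ} (hp : p ∈ pencilCone A) : 0 ≤ MvPolynomial.eval x p := by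
  obtain ⟨c, hc, k, u, rfl⟩ := hp
  rw [map_add, MvPolynomial.eval_C]
  exact add_nonneg hc (eval_quadSum_nonneg hx _)

theorem eval_eq_zero_of_mem_radical {x : Fin n → ℝ} (hx : x ∈ spectrahedron A)
    {p : MvPolynomial (Fin n) ℝ}
    (hp : p ∈ ((pencilModule A).support (isUnit_two n)).radical) :
    MvPolynomial.eval x p = 0 := by
  obtain ⟨k, h₁, h₂⟩ := hp
  have h₃ := eval_nonneg_of_mem_pencilModule hx h₁
  have h₄ := eval_nonneg_of_mem_pencilModule hx h₂
  rw [map_neg] at h₄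
  rw [map_pow] at h₃ h₄
  exact eq_zero_of_pow_eq_zero (n := k) (by linarith)

/-- A polynomial version of the fact that isotropic vectors of a semidefinite form lie in its
kernel. -/
theorem mulVec_mem_radical (hA : A.IsSymm) {u : Fin α → MvPolynomial (Fin n) ℝ}
    (hu : u ⬝ᵥ A.mulVec u ∈ ((pencilModule A).support (isUnit_two n)).radical) (j : Fin α) :
    A.mulVec u j ∈ ((pencilModule A).support (isUnit_two n)).radical := by
  set g := A.mulVec u j with hg
  have hug : u ⬝ᵥ A.mulVec (Pi.single j 1) = g := by
    rw [Matrix.dotProduct_mulVec, ← Matrix.mulVec_transpose, hA.eq, dotProduct_comm]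
    simp [hg]
  have hjg : (Pi.single j 1 : Fin α → MvPolynomial (Fin n) ℝ) ⬝ᵥ A.mulVec u = g := by simp [hg]
  have hjj : (Pi.single j 1 : Fin α → MvPolynomial (Fin n) ℝ) ⬝ᵥ A.mulVec (Pi.single j 1) =
      A j j := by simp
  -- With `a = A j j`, the form at `2g eⱼ - (a + 1)u` is `4g²a - 4g²(a + 1) + (a + 1)² uᵀAu`. Adding
  -- `(2g)²` leaves `(a + 1)² uᵀAu`, which lies in the radical.
  have hm := dotProduct_mulVec_mem_pencilModule (A := A)
    ((2 * g) • (Pi.single j 1 : Fin α → MvPolynomial (Fin n) ℝ) + (-(A j j + 1)) • u)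
  have hsq : (2 * g) ^ 2 ∈ (pencilModule A).carrier := by
    simpa using (pencilModule A).sq_mul_mem (2 * g) (pencilModule A).one_mem
  have hrad := (pencilModule A).mem_radical_support_of_add_mem (isUnit_two n) hsq hm (by
    convert Ideal.mul_mem_left _ ((A j j + 1) ^ 2) hu using 1
    simp only [Matrix.mulVec_add, Matrix.mulVec_smul, dotProduct_add, add_dotProduct,
      dotProduct_smul, smul_dotProduct, hug, hjg, hjj, smul_eq_mul]
    ring)
  have h2g : 2 * g ∈ ((pencilModule A).support (isUnit_two n)).radical :=
    (Ideal.radical_isRadical _) ⟨2, hrad⟩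
  exact (Ideal.unit_mul_mem_iff_mem _ (isUnit_two n)).1 h2g

end Pencil

/-! ### Coordinates for polynomials of degree at most one -/

section Affine

variable {n : ℕ}

/-- The polynomial of degree at most `1` with given constant and linear coefficients. -/
noncomputable def affinePoly (n : ℕ) : ℝ × (Fin n → ℝ) →ₗ[ℝ] MvPolynomial (Fin n) ℝ where
  toFun e := MvPolynomial.C e.1 + ∑ i, e.2 i • MvPolynomial.X i
  map_add' e e' := by
    simp only [Prod.fst_add, Prod.snd_add, Pi.add_apply, map_add, add_smul,
      Finset.sum_add_distrib]
    abel
  map_smul' r e := by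
    simp [MvPolynomial.smul_eq_C_mul, Finset.mul_sum, mul_assoc]

theorem exists_affinePoly_eq {p : MvPolynomial (Fin n) ℝ} (hp : p.totalDegree ≤ 1) :
    ∃ e, affinePoly n e = p := by
  have h : p ∈ LinearMap.range (affinePoly n) := by
    rw [p.as_sum]
    refine Submodule.sum_mem _ fun m hm => ?_
    have hdeg : m.degree ≤ 1 := (MvPolynomial.le_totalDegree hm).trans hp
    rcases Nat.le_one_iff_eq_zero_or_eq_one.1 hdeg with h0 | h1
    · rw [Finsupp.degree_eq_zero_iff] at h0
      subst h0
      exact ⟨(p.coeff 0, 0), by simp [affinePoly]⟩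
    · obtain ⟨i, rfl⟩ := (Finsupp.sum_eq_one_iff m).1 h1
      refine ⟨(0, Pi.single i (p.coeff (Finsupp.single i 1))), ?_⟩
      simp only [affinePoly, LinearMap.coe_mk, AddHom.coe_mk, map_zero, zero_add]
      rw [Finset.sum_eq_single i (by intro j _ hj; simp [hj]) (by simp)]
      rw [Pi.single_eq_same, MvPolynomial.X, MvPolynomial.smul_monomial, smul_eq_mul, mul_one]
  exact h

theorem eval_affinePoly (x : Fin n → ℝ) (e : ℝ × (Fin n → ℝ)) :
    MvPolynomial.eval x (affinePoly n e) = e.1 + ∑ i, e.2 i * x i := by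
  simp [affinePoly, MvPolynomial.smul_eval]

/-- A linear functional that is positive at the constant `1` is a multiple of a point
evaluation. -/
theorem exists_eval_of_pos (L : ℝ × (Fin n → ℝ) →ₗ[ℝ] ℝ) (h : 0 < L (1, 0)) :
    ∃ x : Fin n → ℝ, ∀ e, L e = L (1, 0) * MvPolynomial.eval x (affinePoly n e) := by
  refine ⟨fun i => L (0, Pi.single i 1) / L (1, 0), fun e => ?_⟩
  have he : e = e.1 • ((1, 0) : ℝ × (Fin n → ℝ)) +
      ∑ i, e.2 i • ((0, Pi.single i 1) : ℝ × (Fin n → ℝ)) := by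
    ext j
    · simp [Prod.fst_sum]
    · simp [Prod.snd_sum, Pi.single_apply]
  rw [eval_affinePoly, mul_add, Finset.mul_sum]
  conv_lhs => rw [he]
  rw [map_add, map_smul, map_sum, smul_eq_mul, mul_comm]
  congr 1
  refine Finset.sum_congr rfl fun i _ => ?_
  rw [map_smul, smul_eq_mul]
  field_simp

end Affine
-- Separating `f` from the cone modulo the radical
section Separation

variable {n α : ℕ} {A : Matrix (Fin α) (Fin α) (MvPolynomial (Fin n) ℝ)}

theorem dotProduct_mulVec_add_sub_mem {R : Type*} [CommRing R] {A : Matrix (Fin α) (Fin α) R}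
    (hA : A.IsSymm) {I : Ideal R} {a : Fin α → R} (ha : ∀ j, A.mulVec a j ∈ I) (b : Fin α → R) :
    (a + b) ⬝ᵥ A.mulVec (a + b) - b ⬝ᵥ A.mulVec b ∈ I := by
  have hab : a ⬝ᵥ A.mulVec b = b ⬝ᵥ A.mulVec a := by
    rw [Matrix.dotProduct_mulVec, ← Matrix.mulVec_transpose, hA.eq, dotProduct_comm]
  have h : ∀ v : Fin α → R, v ⬝ᵥ A.mulVec a ∈ I := fun v =>
    Ideal.sum_mem _ fun j _ => Ideal.mul_mem_left _ _ (ha j)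
  have e : (a + b) ⬝ᵥ A.mulVec (a + b) - b ⬝ᵥ A.mulVec b =
      a ⬝ᵥ A.mulVec a + b ⬝ᵥ A.mulVec a + b ⬝ᵥ A.mulVec a := by
    rw [Matrix.mulVec_add, add_dotProduct, dotProduct_add, dotProduct_add, hab]
    ring
  rw [e]
  exact add_mem (add_mem (h _) (h _)) (h _)

/-- The real vectors on which the pencil vanishes modulo an ideal. -/
def kernelModulo (A : Matrix (Fin α) (Fin α) (MvPolynomial (Fin n) ℝ))
    (I : Ideal (MvPolynomial (Fin n) ℝ)) : Submodule ℝ (Fin α → ℝ) where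
  carrier := {u | ∀ j, A.mulVec (fun i => MvPolynomial.C (u i)) j ∈ I}
  zero_mem' j := by simp [Matrix.mulVec, dotProduct]
  add_mem' {u v} hu hv j := by
    have e : (fun i => (MvPolynomial.C ((u + v) i) : MvPolynomial (Fin n) ℝ)) =
        (fun i => MvPolynomial.C (u i)) + fun i => MvPolynomial.C (v i) := by
      ext1 i
      simp
    rw [e, Matrix.mulVec_add]
    exact add_mem (hu j) (hv j)
  smul_mem' r u hu j := by
    have e : (fun i => (MvPolynomial.C ((r • u) i) : MvPolynomial (Fin n) ℝ)) =
        (MvPolynomial.C r : MvPolynomial (Fin n) ℝ) • fun i => MvPolynomial.C (u i) := by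
      ext1 i
      simp
    rw [e, Matrix.mulVec_smul]
    exact Ideal.mul_mem_left _ _ (hu j)

/-- The quadratic form of a pencil at a constant vector, as a polynomial. -/
noncomputable def pencilForm (A : Matrix (Fin α) (Fin α) (MvPolynomial (Fin n) ℝ))
    (u : Fin α → ℝ) : MvPolynomial (Fin n) ℝ :=
  (fun i => MvPolynomial.C (u i)) ⬝ᵥ A.mulVec fun i => MvPolynomial.C (u i)

theorem pencilForm_smul (r : ℝ) (u : Fin α → ℝ) :
    pencilForm A (r • u) = r ^ 2 • pencilForm A u := by
  have e : (fun i => (MvPolynomial.C ((r • u) i) : MvPolynomial (Fin n) ℝ)) =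
      (MvPolynomial.C r : MvPolynomial (Fin n) ℝ) • fun i => MvPolynomial.C (u i) := by
    ext1 i
    simp
  rw [pencilForm, e, Matrix.mulVec_smul, dotProduct_smul, smul_dotProduct, pencilForm,
    MvPolynomial.smul_eq_C_mul, MvPolynomial.C_pow]
  simp only [smul_eq_mul]
  ring

/-- Moves the form into a finite-dimensional normed space, where compactness arguments apply. -/
theorem exists_continuous_affinePoly_eq_pencilForm (hA : IsLinearPencil A) :
    ∃ Q : (Fin α → ℝ) → ℝ × (Fin n → ℝ), Continuous Q ∧
      ∀ u, affinePoly n (Q u) = pencilForm A u := by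
  choose B hB using fun i j => exists_affinePoly_eq (hA.totalDegree_le i j)
  refine ⟨fun u => ∑ i, ∑ j, (u i * u j) • B i j, by fun_prop, fun u => ?_⟩
  simp only [map_sum, map_smul, hB, pencilForm, dotProduct, Matrix.mulVec, Finset.mul_sum,
    MvPolynomial.smul_eq_C_mul, MvPolynomial.C_mul]
  refine Finset.sum_congr rfl fun i _ => Finset.sum_congr rfl fun j _ => ?_
  ring

/-- A vanishing convex combination of generators of `C_A` and of `-f` modulo the radical of the
support of `M_A` is impossible unless `f` lies in the sum of the two. -/
theorem sum_generators_notMem (hA : A.IsSymm) {f : MvPolynomial (Fin n) ℝ}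
    (hf : f ∉ (pencilCone A : Set (MvPolynomial (Fin n) ℝ)) +
      (((pencilModule A).support (isUnit_two n)).radical : Set (MvPolynomial (Fin n) ℝ)))
    {ι : Type*} [Fintype ι] {w c d : ι → ℝ} {u : ι → Fin α → ℝ}
    (hw : ∀ i, 0 ≤ w i) (hw1 : ∑ i, w i = 1) (hc : ∀ i, 0 ≤ c i) (hd : ∀ i, 0 ≤ d i)
    (hu : ∀ i, c i = 0 → d i = 0 →
      u i ∉ kernelModulo A ((pencilModule A).support (isUnit_two n)).radical) :
    ∑ i, w i • (MvPolynomial.C (c i) - d i • f + pencilForm A (u i)) ∉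
      ((pencilModule A).support (isUnit_two n)).radical := by
  set I := ((pencilModule A).support (isUnit_two n)).radical
  intro hmem
  have hone : (1 : MvPolynomial (Fin n) ℝ) ∉ I := fun h =>
    hf ⟨0, zero_mem_pencilCone, f, by simpa using I.mul_mem_left f h, zero_add f⟩
  have e : ∑ i, w i • (MvPolynomial.C (c i) - d i • f + pencilForm A (u i)) =
      ∑ i, w i • (MvPolynomial.C (c i) + pencilForm A (u i)) - (∑ i, w i * d i) • f := by
    rw [Finset.sum_smul, ← Finset.sum_sub_distrib]
    refine Finset.sum_congr rfl fun i _ => ?_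
    module
  rw [e] at hmem
  have hD : ∀ i ∈ Finset.univ, 0 ≤ w i * d i := fun i _ => mul_nonneg (hw i) (hd i)
  -- If the total coefficient of `-f` vanishes, a sum of elements of `M_A` lies in `I`, and a term
  -- of positive weight contradicts `hu`. Otherwise, dividing by that coefficient puts `f` in `C_A +
  -- I`.
  rcases (Finset.sum_nonneg hD).eq_or_lt with hD0 | hD0
  · rw [← hD0, zero_smul, sub_zero] at hmem
    have hterm := fun i => (pencilModule A).mem_radical_support_of_sum_mem (isUnit_two n)
      (fun i _ => smul_mem_pencilModule (hw i) ((pencilModule A).add_mem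
        (C_mem_pencilModule (hc i)) (dotProduct_mulVec_mem_pencilModule _))) hmem
        (Finset.mem_univ i)
    obtain ⟨i, hi⟩ : ∃ i, 0 < w i := by
      by_contra! h
      have := Finset.sum_nonpos fun i (_ : i ∈ Finset.univ) => h i
      linarith
    have hsum : MvPolynomial.C (c i) + pencilForm A (u i) ∈ I := by
      have := I.mul_mem_left (MvPolynomial.C (w i)⁻¹) (hterm i)
      rw [MvPolynomial.smul_eq_C_mul, ← mul_assoc, ← MvPolynomial.C_mul,
        inv_mul_cancel₀ hi.ne', MvPolynomial.C_1, one_mul] at this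
      exact this
    have hCi := (pencilModule A).mem_radical_support_of_add_mem (isUnit_two n)
      (C_mem_pencilModule (hc i)) (dotProduct_mulVec_mem_pencilModule _) hsum
    have hci : c i = 0 := by
      by_contra h
      refine hone ?_
      have := I.mul_mem_left (MvPolynomial.C (c i)⁻¹) hCi
      rwa [← MvPolynomial.C_mul, inv_mul_cancel₀ h, MvPolynomial.C_1] at this
    have hdi : d i = 0 := by
      have := (Finset.sum_eq_zero_iff_of_nonneg hD).1 hD0.symm i (Finset.mem_univ i)
      exact (mul_eq_zero.1 this).resolve_left hi.ne'
    refine hu i hci hdi fun j => mulVec_mem_radical hA ?_ j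
    rwa [hci, MvPolynomial.C_0, zero_add] at hsum
  · set D := ∑ i, w i * d i
    set g := ∑ i, w i • (MvPolynomial.C (c i) + pencilForm A (u i))
    refine hf ⟨D⁻¹ • g, smul_mem_pencilCone (inv_nonneg.2 hD0.le) (sum_mem_pencilCone _
      fun i _ => smul_mem_pencilCone (hw i) ((pencilCone A).add_mem (C_mem_pencilCone (hc i))
        (dotProduct_mulVec_mem_pencilCone _))), -(D⁻¹ • (g - D • f)), ?_, ?_⟩
    · rw [MvPolynomial.smul_eq_C_mul]
      exact neg_mem (I.mul_mem_left _ hmem)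
    · simp only
      rw [smul_sub, smul_smul, inv_mul_cancel₀ hD0.ne', one_smul]
      abel

theorem exists_mem_spectrahedron_eval_neg (hA : IsLinearPencil A) {f : MvPolynomial (Fin n) ℝ}
    (hdeg : f.totalDegree ≤ 1)
    (hf : f ∉ (pencilCone A : Set (MvPolynomial (Fin n) ℝ)) +
      (((pencilModule A).support (isUnit_two n)).radical : Set (MvPolynomial (Fin n) ℝ))) :
    ∃ x ∈ spectrahedron A, MvPolynomial.eval x f < 0 := by
  set I := ((pencilModule A).support (isUnit_two n)).radical
  obtain ⟨φ, hφ⟩ := exists_affinePoly_eq hdeg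
  obtain ⟨Q, hQc, hQ⟩ := exists_continuous_affinePoly_eq_pencilForm hA
  -- Vectors in the kernel have form `0` modulo `I`; passing to a complement keeps `0` out of the
  -- image of the sphere.
  obtain ⟨V, hV⟩ := (kernelModulo A I).exists_isCompl
  let W : Submodule ℝ (ℝ × (Fin n → ℝ)) := (I.restrictScalars ℝ).comap (affinePoly n)
  -- Coordinates on the quotient by `W` make it a concrete normed space; a functional that factors
  -- through `q` vanishes on `I` automatically.
  let q : ℝ × (Fin n → ℝ) →ₗ[ℝ] (Fin (Module.finrank ℝ (_ ⧸ W)) → ℝ) :=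
    (Module.finBasis ℝ (_ ⧸ W)).equivFun.toLinearMap ∘ₗ W.mkQ
  have hq : ∀ e, q e = 0 ↔ affinePoly n e ∈ I := fun e => by
    simp [q, W]
  let K : Set (ℝ × ℝ × (Fin α → ℝ)) :=
    Metric.sphere 0 1 ∩ {p | 0 ≤ p.1 ∧ 0 ≤ p.2.1 ∧ p.2.2 ∈ V}
  have hK : IsCompact K := by
    refine (isCompact_sphere 0 1).inter_right ?_
    refine (isClosed_le continuous_const continuous_fst).inter
      ((isClosed_le continuous_const continuous_snd.fst).inter ?_)
    exact V.closed_of_finiteDimensional.preimage continuous_snd.snd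
  let G : ℝ × ℝ × (Fin α → ℝ) → ℝ × (Fin n → ℝ) := fun p => (p.1, 0) - p.2.1 • φ + Q p.2.2
  have hG : ∀ p, affinePoly n (G p) =
      MvPolynomial.C p.1 - p.2.1 • f + pencilForm A p.2.2 := fun p => by
    simp only [G, map_add, map_sub, map_smul, hφ, hQ]
    simp [affinePoly]
  have hGc : Continuous fun p => q (G p) :=
    q.continuous_of_finiteDimensional.comp (by fun_prop)
  have hzero : (0 : Fin _ → ℝ) ∉ convexHull ℝ ((fun p => q (G p)) '' K) := by
    intro h
    obtain ⟨ι, _, w, z, hw, hw1, hz, hsum⟩ := mem_convexHull_iff_exists_fintype.1 h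
    choose p hpK hpz using hz
    refine sum_generators_notMem hA.isSymm hf hw hw1 (c := fun i => (p i).1)
      (d := fun i => (p i).2.1) (u := fun i => (p i).2.2) (fun i => (hpK i).2.1)
      (fun i => (hpK i).2.2.1) (fun i h1 h2 h3 => ?_) ?_
    · have h0 : (p i).2.2 = 0 :=
        Submodule.disjoint_def.1 hV.disjoint _ h3 (hpK i).2.2.2
      have hp0 : p i = 0 := Prod.ext h1 (Prod.ext h2 h0)
      have := (hpK i).1
      rw [hp0] at this
      simp at this
    · simp only [← hG, ← map_smul, ← map_sum]
      rw [← hq, ← hsum, map_sum]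
      exact Finset.sum_congr rfl fun i _ => by rw [map_smul, ← hpz i]
  obtain ⟨L, s, hL0, hL⟩ := geometric_hahn_banach_point_closed (convex_convexHull ℝ _)
    (isCompact_convexHull_of_isCompact (hK.image hGc)).isClosed hzero
  rw [map_zero] at hL0
  let l : ℝ × (Fin n → ℝ) →ₗ[ℝ] ℝ := L.toLinearMap ∘ₗ q
  have hlG : ∀ p ∈ K, 0 < l (G p) := fun p hp =>
    hL0.trans (hL _ (subset_convexHull ℝ _ ⟨p, hp, rfl⟩))
  have hl0 : ∀ e, affinePoly n e ∈ I → l e = 0 := fun e he => by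
    simp [l, (hq e).2 he]
  have hlc : ∀ e e', affinePoly n e - affinePoly n e' ∈ I → l e = l e' := fun e e' h => by
    rw [← map_sub] at h
    rw [← sub_eq_zero, ← map_sub, hl0 _ h]
  have hQ0 : pencilForm A 0 = 0 := by simp [pencilForm, dotProduct]
  have hone : 0 < l (1, 0) := by
    have h := hlG (1, 0, 0) ⟨by simp [Prod.norm_def], by simp⟩
    rwa [hlc _ (1, 0)] at h
    rw [hG]
    simp [hQ0, affinePoly]
  have hneg : l φ < 0 := by
    have h := hlG (0, 1, 0) ⟨by simp [Prod.norm_def], by simp⟩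
    rw [hlc _ (-φ), map_neg] at h
    · linarith
    rw [hG, map_neg, hφ]
    simp [hQ0]
  -- Only unit vectors are covered by the separation; the others are rescaled, the form being
  -- homogeneous of degree two modulo `I`.
  have hVpos : ∀ v ∈ V, 0 ≤ l (Q v) := fun v hv => by
    rcases eq_or_ne v 0 with rfl | hv0
    · exact (hl0 _ (by simp [hQ, hQ0])).ge
    · have hn : ‖v‖ ≠ 0 := norm_ne_zero_iff.2 hv0
      have h := hlG (0, 0, ‖v‖⁻¹ • v)
        ⟨by simp [Prod.norm_def, norm_smul, hn], by simpa using V.smul_mem _ hv⟩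
      rw [hlc _ ((‖v‖⁻¹ ^ 2) • Q v), map_smul, smul_eq_mul] at h
      · exact (pos_of_mul_pos_right h (sq_nonneg _)).le
      rw [hG, map_smul, hQ, pencilForm_smul]
      simp
  -- Modulo `I` the form depends only on the component in `V`.
  have hpos : ∀ u, 0 ≤ l (Q u) := fun u => by
    obtain ⟨a, ha, b, hb, rfl⟩ : ∃ a ∈ kernelModulo A I, ∃ b ∈ V, a + b = u :=
      Submodule.mem_sup.1 (hV.sup_eq_top ▸ Submodule.mem_top)
    rw [hlc _ (Q b)]
    · exact hVpos b hb
    have e : (fun i => (MvPolynomial.C ((a + b) i) : MvPolynomial (Fin n) ℝ)) =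
        (fun i => MvPolynomial.C (a i)) + fun i => MvPolynomial.C (b i) := by
      ext1 i
      simp
    rw [hQ, hQ, pencilForm, pencilForm, e]
    exact dotProduct_mulVec_add_sub_mem hA.isSymm ha _
  obtain ⟨x, hx⟩ := exists_eval_of_pos l hone
  refine ⟨x, Matrix.PosSemidef.of_dotProduct_mulVec_nonneg ?_ fun u => ?_, ?_⟩
  · ext i j
    simp [hA.isSymm.apply i j]
  · have h := hpos u
    rw [hx, hQ, pencilForm, eval_dotProduct_mulVec] at h
    simpa using nonneg_of_mul_nonneg_right h hone
  · rw [hx, hφ] at hneg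
    exact neg_of_mul_neg_right hneg hone.le

end Separation

end LMI

theorem mainTheorem6 (n α : ℕ) (A : Matrix (Fin α) (Fin α) (MvPolynomial (Fin n) ℝ))
    (hA : LMI.IsLinearPencil A) (f : MvPolynomial (Fin n) ℝ) (hf : f.totalDegree ≤ 1) :
    (∀ x ∈ LMI.spectrahedron A, 0 ≤ MvPolynomial.eval x f) ↔
      f ∈ (LMI.pencilCone A : Set (MvPolynomial (Fin n) ℝ)) +
        (((LMI.pencilModule A).support (LMI.isUnit_two n)).radical :
          Set (MvPolynomial (Fin n) ℝ)) := by
  constructor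
  · intro h
    by_contra hn
    obtain ⟨x, hx, hlt⟩ := LMI.exists_mem_spectrahedron_eval_neg hA hf hn
    exact (h x hx).not_gt hlt
  · rintro ⟨p, hp, r, hr, rfl⟩ x hx
    simp only [map_add]
    rw [LMI.eval_eq_zero_of_mem_radical hx hr, add_zero]
    exact LMI.eval_nonneg_of_mem_pencilCone hx hp
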